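/- Let $G$ be a non-archimedean Polish group, i.e. a topological group whose topology is separable and completely metrizable and whose identity element has a basis of neighbourhoods consisting of open subgroups. Then $G$ is extremely amenable (every continuous action $G\times K\to K$ of $G$ on a nonempty compact Hausdorff space $K$ has a fixed point) if and only if every continuous action $G\times D^{\aleph_0}\to D^{\aleph_0}$ of $G$ on the Cantor set $D^{\aleph_0}$ (where $D=\{0,1\}$ is discrete) has a fixed point. -/

import Mathlib

universe v u

/-- A topological group `G` is extremely amenable if every continuous action of `G` on a nonempty
compact Hausdorff space has a fixed point. (A `MulAction` with `ContinuousSMul` is an action which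
is jointly continuous as a map `G × K → K`.) -/
def ExtremelyAmenable (G : Type u) [Group G] [TopologicalSpace G] : Prop :=
  ∀ (K : Type v) [TopologicalSpace K] [CompactSpace K] [T2Space K] [Nonempty K]
    [MulAction G K] [ContinuousSMul G K], ∃ x : K, ∀ g : G, g • x = x

/-- The Cantor set `D^ℵ₀`, where `D = {0, 1}` is discrete, with the product topology. -/
abbrev CantorSpace : Type := ℕ → Bool

/-!
Extreme amenability passes to the Cantor set (lifted to the right universe) by definition. For the
converse, the proof reduces an arbitrary compact flow to shift flows on finite colourings of a
countable set of cosets.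

Let `V` be an open subgroup of `G` and `A` a finite set. The coset space `G ⧸ V` is discrete, and
countable because `G` is separable, so `G` acts continuously by shifts on the compact metrizable
zero-dimensional space `G ⧸ V → A`. The closure `X` of the orbit of a colouring `c` is again
compact, metrizable and zero-dimensional, but it may have isolated points. Multiplying by a Cantor
set on which `G` acts trivially repairs this: by Brouwer's theorem `X × D^ℵ₀` is homeomorphic to
`D^ℵ₀` (`nonempty_homeomorph_cantorSpace`), so `G` fixes a point of it and hence a point of `X`
(`exists_fixedPoint_of_cantorSpace`). Since `G` is transitive on `G ⧸ V`, that point is a constant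
colouring, and it lies in the closure of the orbit of `c`. Thus every finite pattern in `G` has a
translate on which `c` is constant (`exists_forall_color_eq`).

Now let `G` act on a compact Hausdorff space `K`, let `p : K`, and let an entourage `E` and a finite
subset `F` of `G` be given. For a suitable open subgroup `V`, elements of `V` move all points of `K`
by very little, so up to a small error `y • p` depends only on the coset `V y`; covering `K` by
finitely many small balls gives a finite colouring of these cosets. A translate `y` for which this
colouring is constant on `{y} ∪ F y` yields a point `y • p` that every element of `F` moves by less
than `E` (`exists_almostFixed`). Compactness of `K` turns such almost fixed points into a fixed
point.
-/

open Set Topology Filter Uniformity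

/-! ### Brouwer's characterization of the Cantor space -/

/-- Given a rule `E` which attaches to a stage `n` and a set `D` a set `E n D` used to split `D`,
the piece of the `n`-th partition of `X` that contains `x`, where each partition arises from the
preceding one by splitting all pieces. -/
def splitCell {X : Type*} (E : ℕ → Set X → Set X) (x : X) : ℕ → Set X
  | 0 => univ
  | n + 1 => {y ∈ splitCell E x n | y ∈ E n (splitCell E x n) ↔ x ∈ E n (splitCell E x n)}

open Classical in
/-- The address of `x`: its `n`-th entry tells on which side of the `n`-th splitting `x` lies. -/
noncomputable def splitCode {X : Type*} (E : ℕ → Set X → Set X) (x : X) : ℕ → Bool :=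
  fun n ↦ decide (x ∈ E n (splitCell E x n))

section splitCell

variable {X : Type*} (E : ℕ → Set X → Set X)

theorem mem_splitCell_self (x : X) (n : ℕ) : x ∈ splitCell E x n := by
  induction n with
  | zero => trivial
  | succ n ih => exact ⟨ih, Iff.rfl⟩

theorem splitCell_eq_of_mem {x y : X} {n : ℕ} (h : y ∈ splitCell E x n) :
    splitCell E y n = splitCell E x n := by
  induction n with
  | zero => rfl
  | succ n ih =>
    obtain ⟨h₁, h₂⟩ := h
    simp only [splitCell, ih h₁, h₂]

theorem splitCode_eq_of_mem {x y : X} {n : ℕ} (h : y ∈ splitCell E x n) {i : ℕ} (hi : i < n) :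
    splitCode E y i = splitCode E x i := by
  induction n with
  | zero => omega
  | succ n ih =>
    obtain ⟨h₁, h₂⟩ := h
    rcases Nat.lt_succ_iff_lt_or_eq.1 hi with hi | rfl
    · exact ih h₁ hi
    · rw [splitCode, splitCode, splitCell_eq_of_mem E h₁, decide_eq_decide]
      exact h₂

theorem mem_splitCell_of_splitCode_eq {x y : X} {n : ℕ}
    (h : ∀ i < n, splitCode E y i = splitCode E x i) : y ∈ splitCell E x n := by
  induction n with
  | zero => trivial
  | succ n ih =>
    have h₁ := ih fun i hi ↦ h i (by omega)
    have h₂ := h n (by omega)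
    rw [splitCode, splitCode, splitCell_eq_of_mem E h₁, decide_eq_decide] at h₂
    exact ⟨h₁, h₂⟩

variable {E} [TopologicalSpace X]

theorem isOpen_splitCell (hE : ∀ n D, IsClopen (E n D)) (x : X) (n : ℕ) :
    IsOpen (splitCell E x n) := by
  induction n with
  | zero => exact isOpen_univ
  | succ n ih =>
    by_cases hx : x ∈ E n (splitCell E x n)
    · simp only [splitCell, hx, iff_true]
      exact ih.inter (hE n _).isOpen
    · simp only [splitCell, hx, iff_false]
      exact ih.inter (hE n _).compl.isOpen

theorem continuous_splitCode (hE : ∀ n D, IsClopen (E n D)) : Continuous (splitCode E) := by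
  refine continuous_pi fun n ↦ (IsLocallyConstant.iff_eventually_eq _).2 (fun x ↦ ?_) |>.continuous
  filter_upwards [(isOpen_splitCell hE x (n + 1)).mem_nhds (mem_splitCell_self E x _)] with y hy
  exact splitCode_eq_of_mem E hy n.lt_succ_self

/-- If each piece is split into two nonempty halves, then every address occurs: by compactness it
suffices to realize its finite initial segments. -/
theorem surjective_splitCode [CompactSpace X] [Nonempty X] (hE : ∀ n D, IsClopen (E n D))
    (hne : ∀ n D, IsOpen D → D.Nonempty → (D ∩ E n D).Nonempty ∧ (D \ E n D).Nonempty) :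
    Function.Surjective (splitCode E) := by
  intro b
  have key : ∀ n, ∃ x, ∀ i < n, splitCode E x i = b i := by
    intro n
    induction n with
    | zero => exact ⟨Classical.arbitrary X, fun i hi ↦ by omega⟩
    | succ n ih =>
      obtain ⟨x, hx⟩ := ih
      obtain ⟨⟨z₁, hz₁, hz₁'⟩, ⟨z₀, hz₀, hz₀'⟩⟩ :=
        hne n _ (isOpen_splitCell hE x n) ⟨x, mem_splitCell_self E x n⟩
      have extend : ∀ z ∈ splitCell E x n, splitCode E z n = b n →
          ∀ i < n + 1, splitCode E z i = b i := by
        intro z hz hzn i hi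
        rcases Nat.lt_succ_iff_lt_or_eq.1 hi with hi | rfl
        · rw [splitCode_eq_of_mem E hz hi, hx i hi]
        · exact hzn
      cases hb : b n with
      | true => exact ⟨z₁, extend z₁ hz₁ (by simp [splitCode, splitCell_eq_of_mem E hz₁, hz₁', hb])⟩
      | false =>
        exact ⟨z₀, extend z₀ hz₀ (by simp [splitCode, splitCell_eq_of_mem E hz₀, hz₀', hb])⟩
  have hclosed : ∀ n, IsClosed {x | ∀ i < n, splitCode E x i = b i} := by
    intro n
    simp only [ofPred_forall]
    exact isClosed_iInter fun i ↦ isClosed_iInter fun _ ↦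
      isClosed_eq ((continuous_apply i).comp (continuous_splitCode hE)) continuous_const
  obtain ⟨x, hx⟩ := IsCompact.nonempty_iInter_of_sequence_nonempty_isCompact_isClosed
    (fun n ↦ {x | ∀ i < n, splitCode E x i = b i}) (fun n x hx i hi ↦ hx i (by omega)) key
    (hclosed 0).isCompact hclosed
  exact ⟨x, funext fun i ↦ mem_iInter.1 hx (i + 1) i i.lt_succ_self⟩

end splitCell

/-- Brouwer's theorem. The clopen sets are enumerated, and a piece is split at stage `n` by the
`n`-th clopen set whenever that set cuts it properly. Any two points end up in different pieces,
so the address map is a continuous bijection. -/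
theorem nonempty_homeomorph_cantorSpace (X : Type*) [TopologicalSpace X] [CompactSpace X]
    [T2Space X] [TotallyDisconnectedSpace X] [SecondCountableTopology X] [PerfectSpace X]
    [Nonempty X] : Nonempty (X ≃ₜ CantorSpace) := by
  have : Countable (TopologicalSpace.Clopens X) :=
    TopologicalSpace.Clopens.countable_iff_secondCountable.2 inferInstance
  obtain ⟨C, hC⟩ := exists_surjective_nat (TopologicalSpace.Clopens X)
  have hsep : ∀ x y : X, x ≠ y → ∃ n, x ∈ C n ∧ y ∉ C n := by
    intro x y hxy
    obtain ⟨U, hU, hxU, hyU⟩ := exists_isClopen_of_totally_separated hxy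
    obtain ⟨n, hn⟩ := hC ⟨U, hU⟩
    exact ⟨n, by rw [hn]; exact hxU, by rw [hn]; exact hyU⟩
  have hsplit : ∀ (n : ℕ) (D : Set X), ∃ E : Set X, IsClopen E ∧
      (IsOpen D → D.Nonempty → (D ∩ E).Nonempty ∧ (D \ E).Nonempty) ∧
      ((D ∩ C n).Nonempty → (D \ C n).Nonempty → E = C n) := by
    intro n D
    by_cases h : (D ∩ C n).Nonempty ∧ (D \ C n).Nonempty
    · exact ⟨C n, (C n).isClopen, fun _ _ ↦ h, fun _ _ ↦ rfl⟩
    by_cases hD : IsOpen D ∧ D.Nonempty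
    · obtain ⟨hDo, x, hx⟩ := hD
      obtain ⟨y, hyD, hyx⟩ : (D ∩ {x}ᶜ).Nonempty :=
        have := PerfectSpace.not_isolated x
        Filter.nonempty_of_mem (f := 𝓝[≠] x)
          (inter_mem (mem_nhdsWithin_of_mem_nhds (hDo.mem_nhds hx)) self_mem_nhdsWithin)
      obtain ⟨m, hym, hxm⟩ := hsep y x hyx
      exact ⟨C m, (C m).isClopen, fun _ _ ↦ ⟨⟨y, hyD, hym⟩, ⟨x, hx, hxm⟩⟩,
        fun h₁ h₂ ↦ (h ⟨h₁, h₂⟩).elim⟩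
    · exact ⟨∅, isClopen_empty, fun h₁ h₂ ↦ (hD ⟨h₁, h₂⟩).elim, fun h₁ h₂ ↦ (h ⟨h₁, h₂⟩).elim⟩
  choose E hE hne hEC using hsplit
  have hinj : Function.Injective (splitCode E) := by
    intro x y hxy
    by_contra hne
    obtain ⟨n, hxn, hyn⟩ := hsep x y hne
    have hy : y ∈ splitCell E x (n + 1) :=
      mem_splitCell_of_splitCode_eq E fun i _ ↦ (congrFun hxy i).symm
    have h := hy.2
    rw [hEC n (splitCell E x n) ⟨x, mem_splitCell_self E x n, hxn⟩ ⟨y, hy.1, hyn⟩] at h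
    exact hyn (h.2 hxn)
  exact ⟨Continuous.homeoOfEquivCompactToT2
    (f := Equiv.ofBijective _ ⟨hinj, surjective_splitCode hE hne⟩) (continuous_splitCode hE)⟩

instance perfectSpace_prod_cantorSpace (X : Type*) [TopologicalSpace X] :
    PerfectSpace (X × CantorSpace) := by
  refine perfectSpace_iff_forall_not_isolated.2 fun ⟨x, z⟩ ↦ ?_
  -- `(x, z)` is the limit of the points obtained by changing a single digit of `z`.
  have hlim : Tendsto (fun n ↦ (x, Function.update z n (!z n))) atTop (𝓝[≠] (x, z)) := by
    refine tendsto_nhdsWithin_iff.2 ⟨?_, Eventually.of_forall fun n h ↦ ?_⟩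
    · refine tendsto_const_nhds.prodMk_nhds (tendsto_pi_nhds.2 fun i ↦ ?_)
      refine tendsto_const_nhds.congr' ?_
      filter_upwards [eventually_gt_atTop i] with n hn
      rw [Function.update_of_ne hn.ne]
    · have := congrFun (congrArg Prod.snd h) n
      simp at this
  exact hlim.neBot

/-! ### Fixed points in zero-dimensional metrizable flows -/

section Flows

variable {G : Type u} [Group G] [TopologicalSpace G]

/-- The product of a zero-dimensional compact metrizable flow with a trivial flow on the Cantor
space is a flow on the Cantor space. -/
theorem exists_fixedPoint_of_cantorSpace
    (hG : ∀ [MulAction G CantorSpace] [ContinuousSMul G CantorSpace],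
      ∃ x : CantorSpace, ∀ g : G, g • x = x)
    (X : Type*) [TopologicalSpace X] [CompactSpace X] [T2Space X] [TotallyDisconnectedSpace X]
    [SecondCountableTopology X] [Nonempty X] [MulAction G X] [ContinuousSMul G X] :
    ∃ x : X, ∀ g : G, g • x = x := by
  obtain ⟨e⟩ := nonempty_homeomorph_cantorSpace (X × CantorSpace)
  let : MulAction G CantorSpace :=
    { smul := fun g z ↦ e (g • (e.symm z).1, (e.symm z).2)
      one_smul := fun z ↦ show e ((1 : G) • (e.symm z).1, (e.symm z).2) = z by simp
      mul_smul := fun g h z ↦ show e ((g * h) • (e.symm z).1, (e.symm z).2) =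
          e (g • (e.symm (e (h • (e.symm z).1, (e.symm z).2))).1,
            (e.symm (e (h • (e.symm z).1, (e.symm z).2))).2) by simp [mul_smul] }
  have : ContinuousSMul G CantorSpace :=
    ⟨show Continuous fun q : G × CantorSpace ↦ e (q.1 • (e.symm q.2).1, (e.symm q.2).2) by
      fun_prop⟩
  obtain ⟨z, hz⟩ := hG
  refine ⟨(e.symm z).1, fun g ↦ ?_⟩
  have h : e (g • (e.symm z).1, (e.symm z).2) = z := hz g
  simpa using congrArg (fun w ↦ (e.symm w).1) h

attribute [local instance] arrowAction

theorem continuousSMul_arrow_of_discrete [IsTopologicalGroup G] {S A : Type*} [TopologicalSpace S]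
    [DiscreteTopology S] [MulAction G S] [ContinuousSMul G S] [TopologicalSpace A] :
    ContinuousSMul G (S → A) := by
  refine ⟨continuous_pi fun s ↦ continuous_iff_continuousAt.2 fun ⟨g₀, f₀⟩ ↦ ?_⟩
  have hs : ∀ᶠ q : G × (S → A) in 𝓝 (g₀, f₀), q.1⁻¹ • s = g₀⁻¹ • s := by
    have hcont : Continuous fun q : G × (S → A) ↦ q.1⁻¹ • s := by fun_prop
    exact hcont.continuousAt.eventually ((isOpen_discrete {g₀⁻¹ • s}).mem_nhds (mem_singleton _))
  have hloc : ContinuousAt (fun q : G × (S → A) ↦ q.2 (g₀⁻¹ • s)) (g₀, f₀) :=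
    ((continuous_apply (g₀⁻¹ • s)).comp continuous_snd).continuousAt
  refine hloc.congr ?_
  filter_upwards [hs] with q hq
  exact congrArg q.2 hq.symm

/-- A fixed point in the closure of the orbit of `c` under the shift is a constant colouring,
because `G` is transitive on `G ⧸ V`; its agreement with a translate of `c` on finitely many cosets
is the conclusion. -/
theorem exists_forall_color_eq [IsTopologicalGroup G] [SecondCountableTopology G]
    (hG : ∀ [MulAction G CantorSpace] [ContinuousSMul G CantorSpace],
      ∃ x : CantorSpace, ∀ g : G, g • x = x)
    (V : Subgroup G) (hV : IsOpen (V : Set G)) {A : Type*} [Finite A] (c : G ⧸ V → A)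
    (F : Finset G) : ∃ (y : G) (a : A), ∀ s ∈ F, c ((s * y)⁻¹ : G) = a := by
  let : TopologicalSpace A := ⊥
  have : DiscreteTopology A := ⟨rfl⟩
  have : DiscreteTopology (G ⧸ V) := QuotientGroup.discreteTopology hV
  have : Countable (G ⧸ V) :=
    have : TopologicalSpace.SeparableSpace (G ⧸ V) :=
      QuotientGroup.mk_surjective.denseRange.separableSpace continuous_quot_mk
    TopologicalSpace.separableSpace_iff_countable.1 this
  have : ContinuousSMul G (G ⧸ V → A) := continuousSMul_arrow_of_discrete
  let X : SubMulAction G (G ⧸ V → A) :=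
    { carrier := closure (MulAction.orbit G c)
      smul_mem' := fun g _ hx ↦ smul_closure_orbit_subset g c (smul_mem_smul_set hx) }
  have : CompactSpace X := isCompact_iff_compactSpace.1 isClosed_closure.isCompact
  have : SecondCountableTopology A := DiscreteTopology.secondCountableTopology_of_countable
  have : SecondCountableTopology X :=
    inferInstanceAs (SecondCountableTopology (closure (MulAction.orbit G c)))
  have : Nonempty X := ⟨⟨c, subset_closure (MulAction.mem_orbit_self c)⟩⟩
  have : ContinuousSMul G X :=
    ⟨(continuous_fst.smul (continuous_subtype_val.comp continuous_snd)).subtype_mk _⟩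
  obtain ⟨⟨f, hf⟩, hfix⟩ := exists_fixedPoint_of_cantorSpace hG X
  have hf_smul : ∀ g : G, g • f = f := fun g ↦ congrArg Subtype.val (hfix g)
  have hconst : ∀ g : G, f (g : G ⧸ V) = f ((1 : G) : G ⧸ V) := fun g ↦ by
    have h : f (g⁻¹⁻¹ • ((1 : G) : G ⧸ V)) = f ((1 : G) : G ⧸ V) := congrFun (hf_smul g⁻¹) _
    rwa [inv_inv, MulAction.Quotient.smul_coe, smul_eq_mul, mul_one] at h
  let W : Set (G ⧸ V → A) :=
    ⋂ s ∈ F, {k | k ((s⁻¹ : G) : G ⧸ V) = f ((s⁻¹ : G) : G ⧸ V)}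
  have hW : IsOpen W := isOpen_biInter_finset fun s _ ↦
    (isOpen_discrete {f ((s⁻¹ : G) : G ⧸ V)}).preimage
      (continuous_apply (A := fun _ : G ⧸ V ↦ A) ((s⁻¹ : G) : G ⧸ V))
  obtain ⟨_, hkW, y, rfl⟩ := mem_closure_iff.1 hf W hW (mem_iInter₂.2 fun _ _ ↦ rfl)
  refine ⟨y, f ((1 : G) : G ⧸ V), fun s hs ↦ ?_⟩
  have h : c (y⁻¹ • ((s⁻¹ : G) : G ⧸ V)) = f ((s⁻¹ : G) : G ⧸ V) := mem_iInter₂.1 hkW s hs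
  rw [MulAction.Quotient.smul_coe, smul_eq_mul, ← mul_inv_rev, hconst] at h
  exact h

/-! ### Fixed points in arbitrary compact flows -/

/-- The colouring sends the coset of `y⁻¹` to the centre of a small ball near `y • p`. -/
theorem exists_almostFixed [NonarchimedeanGroup G] [SecondCountableTopology G]
    (hG : ∀ [MulAction G CantorSpace] [ContinuousSMul G CantorSpace],
      ∃ x : CantorSpace, ∀ g : G, g • x = x)
    {K : Type*} [UniformSpace K] [CompactSpace K] [Nonempty K] [MulAction G K] [ContinuousSMul G K]
    {E : Set (K × K)} (hE : E ∈ 𝓤 K) (F : Finset G) : ∃ x : K, ∀ g ∈ F, (g • x, x) ∈ E := by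
  obtain ⟨p⟩ := ‹Nonempty K›
  obtain ⟨E₁, hE₁, hE₁symm, hE₁E⟩ := comp_symm_mem_uniformity_sets hE
  obtain ⟨E₂, hE₂, hE₂symm, hE₂E₁⟩ := comp_symm_mem_uniformity_sets hE₁
  have hnhds : {v : G | ∀ x : K, (v • x, x) ∈ E₂} ∈ 𝓝 (1 : G) := by
    have hcont : Continuous fun q : G × K ↦ (q.1 • q.2, q.2) := by fun_prop
    obtain ⟨u, w, hu, -, h1u, hw, huw⟩ := generalized_tube_lemma
      (isCompact_singleton (x := (1 : G)))
      (isCompact_univ (X := K)) ((isOpen_interior (s := E₂)).preimage hcont) (by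
        rintro ⟨g, x⟩ ⟨rfl, -⟩
        have hx : (x, x) ∈ interior E₂ :=
          mem_interior_iff_mem_nhds.2 (nhds_le_uniformity x hE₂)
        simpa using hx)
    filter_upwards [hu.mem_nhds (singleton_subset_iff.1 h1u)] with v hv x
    have hvx : (v, x) ∈ u ×ˢ w := ⟨hv, hw (mem_univ x)⟩
    exact interior_subset (huw hvx)
  obtain ⟨V, hV⟩ := NonarchimedeanGroup.is_nonarchimedean _ hnhds
  obtain ⟨t, ht⟩ := isCompact_univ.elim_nhds_subcover (fun x : K ↦ {z | (z, x) ∈ E₂})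
    fun x _ ↦ mem_nhds_right x hE₂
  have hcenter : ∀ z : K, ∃ x : t, (z, (x : K)) ∈ E₂ := fun z ↦ by
    obtain ⟨x, hx, hzx⟩ := mem_iUnion₂.1 (ht.2 (mem_univ z))
    exact ⟨⟨x, hx⟩, hzx⟩
  choose center hcenter using hcenter
  let c : G ⧸ (V : Subgroup G) → t := fun q ↦ center (q.out⁻¹ • p)
  have hc : ∀ y : G, (y • p, (c ((y⁻¹ : G) : G ⧸ (V : Subgroup G)) : K)) ∈ E₁ := by
    intro y
    obtain ⟨v, hv⟩ := QuotientGroup.mk_out_eq_mul (V : Subgroup G) y⁻¹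
    set r : G := ((y⁻¹ : G) : G ⧸ (V : Subgroup G)).out with hr
    have hy : y • p = (v : G) • r⁻¹ • p := by rw [hv, ← mul_smul]; congr 1; group
    refine hE₂E₁ ⟨r⁻¹ • p, ?_, hcenter _⟩
    rw [hy]
    exact hV v.2 _
  classical
  obtain ⟨y, a, hya⟩ := exists_forall_color_eq hG (V : Subgroup G) V.isOpen c (insert 1 F)
  refine ⟨y • p, fun g hg ↦ hE₁E ⟨(a : K), ?_, ?_⟩⟩
  · rw [← mul_smul, ← hya g (Finset.mem_insert_of_mem hg)]
    exact hc (g * y)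
  · have h := hc y
    rw [← one_mul y, hya 1 (Finset.mem_insert_self 1 F), one_mul] at h
    exact hE₁symm.symm _ _ h

/-- The closed sets `{x | (g • x, x) ∈ E}`, for `g` in `G` and `E` a closed entourage, have the
finite intersection property, and a point common to all of them is fixed. -/
theorem exists_fixedPoint_of_compact [NonarchimedeanGroup G] [SecondCountableTopology G]
    (hG : ∀ [MulAction G CantorSpace] [ContinuousSMul G CantorSpace],
      ∃ x : CantorSpace, ∀ g : G, g • x = x)
    (K : Type*) [TopologicalSpace K] [CompactSpace K] [T2Space K] [Nonempty K]
    [MulAction G K] [ContinuousSMul G K] : ∃ x : K, ∀ g : G, g • x = x := by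
  let : UniformSpace K := uniformSpaceOfCompactR1
  let ι := G × {E : Set (K × K) // E ∈ 𝓤 K ∧ IsClosed E}
  have hclosed : ∀ i : ι, IsClosed {x : K | (i.1 • x, x) ∈ i.2.1} := fun i ↦
    i.2.2.2.preimage (by fun_prop : Continuous fun x : K ↦ (i.1 • x, x))
  obtain ⟨x, hx⟩ : (⋂ i : ι, {x : K | (i.1 • x, x) ∈ i.2.1}).Nonempty := by
    refine CompactSpace.iInter_nonempty hclosed fun u ↦ ?_
    classical
    obtain ⟨x, hx⟩ := exists_almostFixed hG
      ((biInter_finset_mem u).2 fun i _ ↦ i.2.2.1) (u.image Prod.fst)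
    exact ⟨x, mem_iInter₂.2 fun i hi ↦
      mem_iInter₂.1 (hx i.1 (Finset.mem_image_of_mem _ hi)) i hi⟩
  refine ⟨x, fun g ↦ eq_of_uniformity fun {E} hE ↦ ?_⟩
  obtain ⟨E', hE', hclosed', hsub⟩ := mem_uniformity_isClosed hE
  exact hsub (mem_iInter.1 hx (g, ⟨E', hE', hclosed'⟩))

end Flows

theorem mainTheorem3 (G : Type u) [Group G] [TopologicalSpace G] [PolishSpace G]
    [NonarchimedeanGroup G] :
    ExtremelyAmenable.{v, u} G ↔
      ∀ [MulAction G CantorSpace] [ContinuousSMul G CantorSpace],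
        ∃ x : CantorSpace, ∀ g : G, g • x = x := by
  refine ⟨fun h _ _ ↦ ?_, fun hG K _ _ _ _ _ _ ↦ exists_fixedPoint_of_compact hG K⟩
  let : MulAction G (ULift.{v} CantorSpace) := ULift.mulAction'
  have : ContinuousSMul G (ULift.{v} CantorSpace) :=
    ⟨continuous_uliftUp.comp (continuous_fst.smul (continuous_uliftDown.comp continuous_snd))⟩
  obtain ⟨x, hx⟩ := h (ULift.{v} CantorSpace)
  exact ⟨x.down, fun g ↦ congrArg ULift.down (hx g)⟩
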